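/- Let $n\ge 0$ be an integer, let $P_0\mathbb{R}^n=\{\gamma\in C^0([0,\infty),\mathbb{R}^n):\gamma(0)=0\}$ with the topology of locally uniform convergence and its Borel $\sigma$-algebra, and let $\mathbb{P}_0$ be the Wiener measure on $P_0\mathbb{R}^n$ with generator $\Delta$, i.e. the Borel probability measure such that for all times $0<t_1<\dots<t_k$ the law of $(\gamma(t_1),\dots,\gamma(t_k))$ is $$\rho_{t_1}(0,x_1)\,\rho_{t_2-t_1}(x_1,x_2)\cdots\rho_{t_k-t_{k-1}}(x_{k-1},x_k)\,dx_1\cdots dx_k,\qquad \rho_t(x,y)=(4\pi t)^{-n/2}e^{-|x-y|^2/(4t)}.$$ Let $\mathcal{H}$ be the Cameron–Martin space of all (locally absolutely continuous) paths $h\in P_0\mathbb{R}^n$ with derivative in $L^2$, that is, with $\|h\|_{\mathcal H}^2=\int_0^\infty|\dot h(t)|^2\,dt<\infty$. Let $F:P_0\mathbb{R}^n\to(0,\infty)$ be $\mathbb{P}_0$-integrable and define $$\Phi_F(h)=\ln\left(\int_{P_0\mathbb{R}^n}F(\gamma+h)\,d\mathbb{P}_0(\gamma)\right)+\frac14\|h\|_{\mathcal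 H}^2,\qquad h\in\mathcal{H},$$ where the integral is taken in $[0,\infty]$ and $\ln\infty=\infty$. Then $\Phi_F$ takes values in $(-\infty,\infty]$, $\Phi_F(0)<\infty$, and $\Phi_F$ is convex on $\mathcal{H}$: for all $h_1,h_2\in\mathcal H$ and $\lambda_1,\lambda_2>0$ with $\lambda_1+\lambda_2=1$, $$\Phi_F(\lambda_1h_1+\lambda_2h_2)\le\lambda_1\Phi_F(h_1)+\lambda_2\Phi_F(h_2).$$ In particular, the set $D$ of all $h\in\mathcal{H}$ for which $\gamma\mapsto F(\gamma+h)$ is $\mathbb{P}_0$-integrable is convex, and on $D$ (which is all of $\mathcal{H}$ whenever every translate of $F$ is integrable) $\Phi_F$ is a real-valued convex function. -/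

import Mathlib

open MeasureTheory Set
open scoped NNReal ENNReal

noncomputable section

namespace PathSpaceHarnack

/-- Euclidean space `ℝⁿ` with its Euclidean norm. -/
abbrev E (n : ℕ) : Type := EuclideanSpace ℝ (Fin n)

/-- The based path space `P₀ℝⁿ = {γ ∈ C⁰([0,∞), ℝⁿ) : γ(0) = 0}`, a linear subspace of
`C⁰([0,∞), ℝⁿ)`. It carries the topology of locally uniform convergence (the compact-open
topology), inherited from `C(ℝ≥0, E n)`. -/
def pathSubmodule (n : ℕ) : Submodule ℝ C(ℝ≥0, E n) where
  carrier := {γ | γ 0 = 0}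
  add_mem' := by
    intro a b ha hb
    change (a + b) 0 = 0
    rw [ContinuousMap.add_apply, show a 0 = 0 from ha, show b 0 = 0 from hb, add_zero]
  zero_mem' := by simp
  smul_mem' := by
    intro c a ha
    change (c • a) 0 = 0
    rw [ContinuousMap.smul_apply, show a 0 = 0 from ha, smul_zero]

/-- The based path space `P₀ℝⁿ` as a type. -/
abbrev PathSpace (n : ℕ) : Type := ↥(pathSubmodule n)

/-- Path space is equipped with its Borel `σ`-algebra. -/
instance instMeasurableSpacePathSpace (n : ℕ) : MeasurableSpace (PathSpace n) :=
  borel (PathSpace n)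

instance instBorelSpacePathSpace (n : ℕ) : BorelSpace (PathSpace n) := ⟨rfl⟩

/-- The heat kernel `ρ_t(x,y) = (4πt)^{-n/2} exp(-|x-y|²/(4t))` of `ℝⁿ`, i.e. the fundamental
solution of `∂_t u = Δu` (generator `Δ`, not `½Δ`). -/
def heatKernel (n : ℕ) (t : ℝ) (x y : E n) : ℝ :=
  (4 * Real.pi * t) ^ (-(n : ℝ) / 2) * Real.exp (-‖x - y‖ ^ 2 / (4 * t))

/-- The evaluation map `e_t(γ) = (γ(t₁), …, γ(t_k))`. -/
def evalMap {n k : ℕ} (t : Fin k → ℝ≥0) (γ : PathSpace n) : Fin k → E n :=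
  fun i => γ.1 (t i)

/-- The joint density
`ρ_{t₁}(0,x₁) ρ_{t₂-t₁}(x₁,x₂) ⋯ ρ_{t_k-t_{k-1}}(x_{k-1},x_k)`; `Fin.cons` prepends
`t₀ = 0` and `x₀ = 0`. -/
def wienerDensity {n k : ℕ} (t : Fin k → ℝ≥0) (x : Fin k → E n) : ℝ :=
  ∏ i : Fin k,
    heatKernel n
      (((Fin.cons 0 t : Fin (k + 1) → ℝ≥0) i.succ : ℝ)
        - ((Fin.cons 0 t : Fin (k + 1) → ℝ≥0) i.castSucc : ℝ))
      ((Fin.cons 0 x : Fin (k + 1) → E n) i.castSucc)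
      ((Fin.cons 0 x : Fin (k + 1) → E n) i.succ)

/-- `P` is the Wiener measure `ℙ₀` on `P₀ℝⁿ`: the (unique) Borel probability measure on path space
whose pushforward under the evaluation map at any times `0 < t₁ < ⋯ < t_k` is
`ρ_{t₁}(0,dx₁) ρ_{t₂-t₁}(x₁,dx₂) ⋯ ρ_{t_k-t_{k-1}}(x_{k-1},dx_k)`. -/
structure IsWienerMeasure (n : ℕ) (P : Measure (PathSpace n)) : Prop where
  isProbabilityMeasure : IsProbabilityMeasure P
  map_evalMap : ∀ (k : ℕ) (t : Fin k → ℝ≥0), (∀ i, 0 < t i) → StrictMono t →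
    P.map (evalMap t) =
      (volume : Measure (Fin k → E n)).withDensity fun x => ENNReal.ofReal (wienerDensity t x)

/-- `v` is an `L²` derivative of the path `h`: `v ∈ L²((0,∞); ℝⁿ)` and `h(t) = ∫₀ᵗ v(s) ds`. -/
def HasL2Deriv {n : ℕ} (h : PathSpace n) (v : ℝ → E n) : Prop :=
  MemLp v 2 (volume.restrict (Ioi (0 : ℝ))) ∧ ∀ t : ℝ≥0, h.1 t = ∫ s in (0 : ℝ)..t, v s

theorem HasL2Deriv.intervalIntegrable {n : ℕ} {h : PathSpace n} {v : ℝ → E n}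
    (hv : HasL2Deriv h v) (t : ℝ≥0) : IntervalIntegrable v volume 0 t := by
  refine (intervalIntegrable_iff_integrableOn_Ioc_of_le (NNReal.coe_nonneg t)).2 ?_
  have h1 : MemLp v 2 (volume.restrict (Ioc (0 : ℝ) t)) :=
    hv.1.mono_measure (Measure.restrict_mono Ioc_subset_Ioi_self le_rfl)
  exact h1.integrable (by norm_num)

/-- The Cameron–Martin space `ℋ`: the paths `h ∈ P₀ℝⁿ` of class `H¹`, i.e. the (locally)
absolutely continuous ones with `∫₀^∞ |ḣ|² dt < ∞`. -/
def CameronMartin (n : ℕ) : Submodule ℝ (PathSpace n) where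
  carrier := {h | ∃ v : ℝ → E n, HasL2Deriv h v}
  add_mem' := by
    rintro a b ⟨v, hv⟩ ⟨w, hw⟩
    refine ⟨v + w, hv.1.add hw.1, fun t => ?_⟩
    have := intervalIntegral.integral_add (hv.intervalIntegrable t) (hw.intervalIntegrable t)
    simp only [Pi.add_apply]
    rw [this, ← hv.2 t, ← hw.2 t]
    rfl
  zero_mem' := ⟨0, MemLp.zero, fun t => by simp⟩
  smul_mem' := by
    rintro c a ⟨v, hv⟩
    refine ⟨c • v, hv.1.const_smul c, fun t => ?_⟩
    simp only [Pi.smul_apply]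
    rw [intervalIntegral.integral_smul, ← hv.2 t]
    rfl

/-- The squared Cameron–Martin norm `‖h‖²_ℋ = ∫₀^∞ |ḣ(t)|² dt`, where `ḣ` is the classical
derivative of `t ↦ h(t)`, which exists for almost every `t > 0` (and agrees almost everywhere
with any `L²` derivative of `h`). -/
def cmNormSq {n : ℕ} (h : CameronMartin n) : ℝ :=
  ∫ t in Ioi (0 : ℝ), ‖deriv (fun s : ℝ => h.1.1 s.toNNReal) t‖ ^ 2

/-- The functional `Φ_F(h) = ln (∫ F(γ + h) dP(γ)) + ¼ ‖h‖²_ℋ` with values in `[-∞, ∞]`: the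
integral of the nonnegative function `γ ↦ F(γ + h)` is taken in `[0, ∞]`, with `ln 0 = -∞` and
`ln ∞ = ∞`. -/
def Phi {n : ℕ} (P : Measure (PathSpace n)) (F : PathSpace n → ℝ) (h : CameronMartin n) : EReal :=
  ENNReal.log (∫⁻ γ, ENNReal.ofReal (F (γ + h.1)) ∂P) + ((1 / 4 * cmNormSq h : ℝ) : EReal)

/-- The same functional `Φ_F(h) = ln (∫ F(γ + h) dP(γ)) + ¼ ‖h‖²_ℋ`, real-valued; meaningful for
those `h` for which `γ ↦ F(γ + h)` is integrable. -/
def PhiReal {n : ℕ} (P : Measure (PathSpace n)) (F : PathSpace n → ℝ) (h : CameronMartin n) : ℝ :=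
  Real.log (∫ γ, F (γ + h.1) ∂P) + 1 / 4 * cmNormSq h

end PathSpaceHarnack

end

/-!
Write `h₀ = a • h₁ + b • h₂` with `a, b > 0` and `a + b = 1`. Everything follows from one Hölder-type
inequality: for all measurable `f ≥ 0` on path space,

  `∫ f(γ + h₀) dP ≤ exp (¼ (a ‖h₁‖² + b ‖h₂‖² - ‖h₀‖²)) (∫ f(γ + h₁) dP)ᵃ (∫ f(γ + h₂) dP)ᵇ`,

whose logarithm is the convexity of `Φ_f`. Here `a ‖h₁‖² + b ‖h₂‖² - ‖h₀‖² = a b ‖h₁ - h₂‖²`.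

If `f` depends on the path at finitely many times only, translating the path translates the Gaussian
density `w` of these values. As `-|x - c|²` is affine in `c` up to the quadratic term `-|c|²`, the
density `w(x - c₀)` is the weighted geometric mean of `w(x - c₁)` and `w(x - c₂)`, up to the constant
`exp (¼ a b S)`, where `S` is the energy of the polygon with vertices on `h₁ - h₂`
(`wienerDensity_sub_convexComb`). Hölder's inequality gives the claim with `S` in place of
`‖h₁ - h₂‖²` (`lintegral_cylinder_convexComb_le`), and `S ≤ ‖h₁ - h₂‖²` by Cauchy-Schwarz
(`HasL2Deriv.polygonEnergy_le`). The constant no longer depends on the chosen times, so Lévy's upward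
theorem, applied to the sum of the three translates of `P`, carries the inequality over to all
measurable `f` (`lintegral_le_rpow_mul_rpow_of_filtration`): the Borel sets of path space are
generated by the values at a dense sequence of times (`iSup_sampleFiltration`).

The function `F` is only measurable up to a `P`-null set, so its translates have to be shown
measurable up to null sets as well. The inequality itself, for the indicator of a null set and
`h = ½ • 0 + ½ • (2 • h)`, shows that translation by `h` preserves null sets
(`IsWienerMeasure.quasiMeasurePreserving`); neither the Cameron-Martin density nor a stochastic
integral is needed.
-/

namespace PathSpaceHarnack

open Filter Topology

/-! ### Log-concavity of the finite-dimensional distributions -/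

/-- The energy `∑ |cᵢ - cᵢ₋₁|² / (tᵢ - tᵢ₋₁)` of the polygonal path that starts at `0` at time `0`
and passes through `cᵢ` at time `tᵢ`. -/
noncomputable def polygonEnergy {n k : ℕ} (t : Fin k → ℝ≥0) (c : Fin k → E n) : ℝ :=
  ∑ i : Fin k,
    ‖(Fin.cons 0 c : Fin (k + 1) → E n) i.castSucc - (Fin.cons 0 c : Fin (k + 1) → E n) i.succ‖ ^ 2 /
      (((Fin.cons 0 t : Fin (k + 1) → ℝ≥0) i.succ : ℝ)
        - ((Fin.cons 0 t : Fin (k + 1) → ℝ≥0) i.castSucc : ℝ))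

theorem heatKernel_pos (n : ℕ) {t : ℝ} (ht : 0 < t) (x y : E n) : 0 < heatKernel n t x y := by
  unfold heatKernel
  positivity

theorem norm_sub_convexComb_sq {V : Type*} [NormedAddCommGroup V] [InnerProductSpace ℝ V]
    {a b : ℝ} (hab : a + b = 1) (z u v : V) :
    ‖z - (a • u + b • v)‖ ^ 2 = a * ‖z - u‖ ^ 2 + b * ‖z - v‖ ^ 2 - a * b * ‖u - v‖ ^ 2 := by
  obtain rfl : b = 1 - a := by linarith
  have h : z - (a • u + (1 - a) • v) = a • (z - u) + (1 - a) • (z - v) := by module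
  have h' : u - v = (z - v) - (z - u) := by abel
  rw [h, h', norm_add_sq_real, norm_sub_sq_real (z - v), inner_smul_left, inner_smul_right, norm_smul,
    norm_smul, mul_pow, mul_pow, Real.norm_eq_abs, Real.norm_eq_abs, sq_abs, sq_abs,
    real_inner_comm (z - u) (z - v)]
  simp only [conj_trivial]
  ring

/-- Under a convex combination of translations, the heat kernel is the geometric mean of its
translates, up to a factor independent of the position. -/
theorem heatKernel_sub_convexComb (n : ℕ) {t : ℝ} (ht : 0 < t) {a b : ℝ} (hab : a + b = 1)
    (x y u u' v v' : E n) :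
    heatKernel n t (x - (a • u + b • v)) (y - (a • u' + b • v')) =
      Real.exp (a * b / 4 * (‖(u - v) - (u' - v')‖ ^ 2 / t)) *
        heatKernel n t (x - u) (y - u') ^ a * heatKernel n t (x - v) (y - v') ^ b := by
  have h := norm_sub_convexComb_sq hab (x - y) (u - u') (v - v')
  have e1 : x - (a • u + b • v) - (y - (a • u' + b • v')) =
      (x - y) - (a • (u - u') + b • (v - v')) := by module
  have e2 : (x - u) - (y - u') = (x - y) - (u - u') := by abel
  have e3 : (x - v) - (y - v') = (x - y) - (v - v') := by abel
  have e4 : (u - v) - (u' - v') = (u - u') - (v - v') := by abel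
  have hA : 0 < (4 * Real.pi * t) ^ (-(n : ℝ) / 2) := by positivity
  unfold heatKernel
  rw [e1, e2, e3, e4, h, Real.mul_rpow hA.le (Real.exp_pos _).le,
    Real.mul_rpow hA.le (Real.exp_pos _).le, ← Real.exp_mul, ← Real.exp_mul]
  have hA' : (4 * Real.pi * t) ^ (-(n : ℝ) / 2) =
      ((4 * Real.pi * t) ^ (-(n : ℝ) / 2)) ^ a * ((4 * Real.pi * t) ^ (-(n : ℝ) / 2)) ^ b := by
    rw [← Real.rpow_add hA, hab, Real.rpow_one]
  set A := (4 * Real.pi * t) ^ (-(n : ℝ) / 2)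
  rw [show ∀ p q r s w : ℝ, p * (q * r) * (s * w) = (q * s) * (p * r * w) by intros; ring,
    ← hA', ← Real.exp_add, ← Real.exp_add]
  congr 2
  field_simp
  ring

theorem cons_zero_lt_cons_zero {k : ℕ} {t : Fin k → ℝ≥0} (ht : ∀ i, 0 < t i) (hmono : StrictMono t)
    (i : Fin k) :
    (Fin.cons 0 t : Fin (k + 1) → ℝ≥0) i.castSucc < (Fin.cons 0 t : Fin (k + 1) → ℝ≥0) i.succ := by
  rw [Fin.cons_succ]
  cases k with
  | zero => exact i.elim0
  | succ k =>
    induction i using Fin.cases with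
    | zero => simpa using ht 0
    | succ i =>
      rw [Fin.castSucc_succ, Fin.cons_succ]
      exact hmono (by simp)

theorem cons_zero_sub {n k : ℕ} (c d : Fin k → E n) (i : Fin (k + 1)) :
    (Fin.cons 0 (c - d) : Fin (k + 1) → E n) i =
      (Fin.cons 0 c : Fin (k + 1) → E n) i - (Fin.cons 0 d : Fin (k + 1) → E n) i := by
  induction i using Fin.cases <;> simp

theorem cons_zero_convexComb {n k : ℕ} (a b : ℝ) (c d : Fin k → E n) (i : Fin (k + 1)) :
    (Fin.cons 0 (a • c + b • d) : Fin (k + 1) → E n) i =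
      a • (Fin.cons 0 c : Fin (k + 1) → E n) i + b • (Fin.cons 0 d : Fin (k + 1) → E n) i := by
  induction i using Fin.cases <;> simp

theorem wienerDensity_nonneg {n k : ℕ} {t : Fin k → ℝ≥0} (ht : ∀ i, 0 < t i) (hmono : StrictMono t)
    (x : Fin k → E n) : 0 ≤ wienerDensity t x :=
  Finset.prod_nonneg fun i _ =>
    (heatKernel_pos n (sub_pos.2 (by exact_mod_cast cons_zero_lt_cons_zero ht hmono i)) _ _).le

/-- The finite-dimensional densities of Brownian motion inherit from the heat kernel that a convex
combination of translations produces a geometric mean; the constant is the energy of the difference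
of the translations. -/
theorem wienerDensity_sub_convexComb {n k : ℕ} {t : Fin k → ℝ≥0} (ht : ∀ i, 0 < t i)
    (hmono : StrictMono t) {a b : ℝ} (hab : a + b = 1) (x c d : Fin k → E n) :
    wienerDensity t (x - (a • c + b • d)) =
      Real.exp (a * b / 4 * polygonEnergy t (c - d)) *
        wienerDensity t (x - c) ^ a * wienerDensity t (x - d) ^ b := by
  have hpos : ∀ i : Fin k, (0 : ℝ) < ((Fin.cons 0 t : Fin (k + 1) → ℝ≥0) i.succ : ℝ)
        - ((Fin.cons 0 t : Fin (k + 1) → ℝ≥0) i.castSucc : ℝ) := fun i =>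
    sub_pos.2 (by exact_mod_cast cons_zero_lt_cons_zero ht hmono i)
  unfold wienerDensity polygonEnergy
  rw [← Real.finsetProd_rpow _ _ fun i _ => (heatKernel_pos n (hpos i) _ _).le,
    ← Real.finsetProd_rpow _ _ fun i _ => (heatKernel_pos n (hpos i) _ _).le,
    Finset.mul_sum, Real.exp_sum, ← Finset.prod_mul_distrib, ← Finset.prod_mul_distrib]
  refine Finset.prod_congr rfl fun i _ => ?_
  simp only [cons_zero_sub x, cons_zero_sub c, cons_zero_convexComb]
  exact heatKernel_sub_convexComb n (hpos i) hab _ _ _ _ _ _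

theorem measurable_wienerDensity {n k : ℕ} (t : Fin k → ℝ≥0) :
    Measurable (wienerDensity t : (Fin k → E n) → ℝ) := by
  have hc : ∀ i : Fin (k + 1), Continuous fun x : Fin k → E n =>
      (Fin.cons 0 x : Fin (k + 1) → E n) i := by
    intro i
    induction i using Fin.cases with
    | zero => simpa using continuous_const
    | succ i => simpa using continuous_apply i
  refine Continuous.measurable ?_
  unfold wienerDensity heatKernel
  exact continuous_finsetProd _ fun i _ => continuous_const.mul
    (Real.continuous_exp.comp (((hc _).sub (hc _)).norm.pow 2 |>.neg.div_const _))

/-- The law of finitely many values of a translated Brownian path is the translated law. -/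
theorem lintegral_wiener_translate {n k : ℕ} {P : Measure (PathSpace n)} (hP : IsWienerMeasure n P)
    {t : Fin k → ℝ≥0} (ht : ∀ i, 0 < t i) (hmono : StrictMono t)
    (heval : Measurable (evalMap t : PathSpace n → _))
    {G : (Fin k → E n) → ℝ≥0∞} (hG : Measurable G) (h : PathSpace n) :
    ∫⁻ γ, G (evalMap t (γ + h)) ∂P =
      ∫⁻ x, G x * ENNReal.ofReal (wienerDensity t (x - evalMap t h)) := by
  have hw : Measurable fun x : Fin k → E n => ENNReal.ofReal (wienerDensity t x) :=
    (measurable_wienerDensity t).ennreal_ofReal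
  have hGh : Measurable fun x => G (x + evalMap t h) := hG.comp (measurable_add_const _)
  calc ∫⁻ γ, G (evalMap t (γ + h)) ∂P = ∫⁻ γ, G (evalMap t γ + evalMap t h) ∂P := rfl
    _ = ∫⁻ x, G (x + evalMap t h) ∂(P.map (evalMap t)) := (lintegral_map hGh heval).symm
    _ = ∫⁻ x, G (x + evalMap t h) * ENNReal.ofReal (wienerDensity t x) := by
      rw [hP.map_evalMap k t ht hmono, lintegral_withDensity_eq_lintegral_mul _ hw hGh]
      simp only [Pi.mul_apply, mul_comm]
    _ = ∫⁻ x, G x * ENNReal.ofReal (wienerDensity t (x - evalMap t h)) := by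
      have := lintegral_add_right_eq_self (μ := volume)
        (fun x => G x * ENNReal.ofReal (wienerDensity t (x - evalMap t h))) (evalMap t h)
      simpa only [add_sub_cancel_right] using this

/-- The key inequality for functions of finitely many values of the path. -/
theorem lintegral_cylinder_convexComb_le {n k : ℕ} {P : Measure (PathSpace n)}
    (hP : IsWienerMeasure n P) {t : Fin k → ℝ≥0} (ht : ∀ i, 0 < t i) (hmono : StrictMono t)
    (heval : Measurable (evalMap t : PathSpace n → _))
    {G : (Fin k → E n) → ℝ≥0∞} (hG : Measurable G) (h₁ h₂ : PathSpace n) {a b : ℝ}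
    (ha : 0 < a) (hb : 0 < b) (hab : a + b = 1) :
    ∫⁻ γ, G (evalMap t (γ + (a • h₁ + b • h₂))) ∂P ≤
      ENNReal.ofReal (Real.exp (a * b / 4 * polygonEnergy t (evalMap t (h₁ - h₂)))) *
        (∫⁻ γ, G (evalMap t (γ + h₁)) ∂P) ^ a * (∫⁻ γ, G (evalMap t (γ + h₂)) ∂P) ^ b := by
  have hm : ∀ h : PathSpace n, Measurable fun x =>
      G x * ENNReal.ofReal (wienerDensity t (x - evalMap t h)) := fun h =>
    hG.mul ((measurable_wienerDensity t).comp (measurable_sub_const _)).ennreal_ofReal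
  rw [lintegral_wiener_translate hP ht hmono heval hG, lintegral_wiener_translate hP ht hmono heval hG,
    lintegral_wiener_translate hP ht hmono heval hG, mul_assoc]
  refine le_trans (le_of_eq ?_) (mul_le_mul_right (ENNReal.lintegral_mul_norm_pow_le
    (hm h₁).aemeasurable (hm h₂).aemeasurable ha.le hb.le hab) _)
  rw [← lintegral_const_mul' _ _ ENNReal.ofReal_ne_top]
  refine lintegral_congr fun x => ?_
  have e : evalMap t (a • h₁ + b • h₂) = a • evalMap t h₁ + b • evalMap t h₂ := rfl
  have e' : evalMap t (h₁ - h₂) = evalMap t h₁ - evalMap t h₂ := rfl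
  have w0 := fun y : Fin k → E n => wienerDensity_nonneg ht hmono y
  have hGx : G x = G x ^ a * G x ^ b := by
    rw [← ENNReal.rpow_add_of_nonneg _ _ ha.le hb.le, hab, ENNReal.rpow_one]
  rw [e, e', wienerDensity_sub_convexComb ht hmono hab,
    ENNReal.ofReal_mul (mul_nonneg (Real.exp_pos _).le (Real.rpow_nonneg (w0 _) _)),
    ENNReal.ofReal_mul (Real.exp_pos _).le, ENNReal.mul_rpow_of_nonneg _ _ ha.le,
    ENNReal.mul_rpow_of_nonneg _ _ hb.le, ENNReal.ofReal_rpow_of_nonneg (w0 _) ha.le,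
    ENNReal.ofReal_rpow_of_nonneg (w0 _) hb.le]
  conv_lhs => rw [hGx]
  ring

/-! ### The energy of inscribed polygons -/

theorem sq_norm_integral_Ioc_le {n : ℕ} {v : ℝ → E n} {s t : ℝ} (hst : s < t)
    (hv : MemLp v 2 (volume.restrict (Ioc s t))) :
    ‖∫ r in s..t, v r‖ ^ 2 / (t - s) ≤ ∫ r in s..t, ‖v r‖ ^ 2 := by
  have hts : 0 < t - s := sub_pos.2 hst
  have h1 : Integrable v (volume.restrict (Ioc s t)) := hv.integrable (by norm_num)
  have h2 : Integrable (fun r => ‖v r‖ ^ 2) (volume.restrict (Ioc s t)) :=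
    hv.integrable_norm_pow (by norm_num)
  set I := ∫ r in s..t, ‖v r‖
  have hI : ‖∫ r in s..t, v r‖ ≤ I := intervalIntegral.norm_integral_le_integral_norm hst.le
  -- Integrating `(‖v‖ - m)² ≥ 0`, with `m` the mean of `‖v‖`, gives Cauchy-Schwarz.
  have hexp : ∫ r in s..t, (‖v r‖ - I / (t - s)) ^ 2 =
      (∫ r in s..t, ‖v r‖ ^ 2) - I ^ 2 / (t - s) := by
    have i1 : IntervalIntegrable (fun r => ‖v r‖) volume s t :=
      (intervalIntegrable_iff_integrableOn_Ioc_of_le hst.le).2 h1.norm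
    have i2 : IntervalIntegrable (fun r => ‖v r‖ ^ 2) volume s t :=
      (intervalIntegrable_iff_integrableOn_Ioc_of_le hst.le).2 h2
    have : ∀ r, (‖v r‖ - I / (t - s)) ^ 2 =
        ‖v r‖ ^ 2 - 2 * (I / (t - s)) * ‖v r‖ + (I / (t - s)) ^ 2 := fun r => by ring
    simp_rw [this]
    rw [intervalIntegral.integral_add (i2.sub (i1.const_mul _)) (by simp),
      intervalIntegral.integral_sub i2 (i1.const_mul _), intervalIntegral.integral_const_mul,
      intervalIntegral.integral_const, smul_eq_mul]
    change _ - _ * I + _ = _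
    field_simp
    ring
  have h0 : 0 ≤ ∫ r in s..t, (‖v r‖ - I / (t - s)) ^ 2 :=
    intervalIntegral.integral_nonneg hst.le fun r _ => sq_nonneg _
  have hle : ‖∫ r in s..t, v r‖ ^ 2 / (t - s) ≤ I ^ 2 / (t - s) := by gcongr
  linarith

theorem HasL2Deriv.memLp_Ioc {n : ℕ} {h : PathSpace n} {v : ℝ → E n} (hv : HasL2Deriv h v)
    (s t : ℝ≥0) : MemLp v 2 (volume.restrict (Ioc (s : ℝ) t)) :=
  hv.1.mono_measure (Measure.restrict_mono
    (fun _ hx => lt_of_le_of_lt (NNReal.coe_nonneg s) hx.1) le_rfl)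

theorem HasL2Deriv.integrableOn_norm_sq {n : ℕ} {h : PathSpace n} {v : ℝ → E n}
    (hv : HasL2Deriv h v) : IntegrableOn (fun r => ‖v r‖ ^ 2) (Ioi 0) :=
  hv.1.integrable_norm_pow (by norm_num)

theorem HasL2Deriv.intervalIntegrable_norm_sq {n : ℕ} {h : PathSpace n} {v : ℝ → E n}
    (hv : HasL2Deriv h v) (s t : ℝ≥0) :
    IntervalIntegrable (fun r => ‖v r‖ ^ 2) volume (s : ℝ) t :=
  intervalIntegrable_iff.2 <| hv.integrableOn_norm_sq.mono_set fun _ hx =>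
    lt_of_le_of_lt (le_min s.coe_nonneg t.coe_nonneg) hx.1

theorem HasL2Deriv.sub_eq {n : ℕ} {h : PathSpace n} {v : ℝ → E n} (hv : HasL2Deriv h v)
    (s t : ℝ≥0) : h.1 t - h.1 s = ∫ r in (s : ℝ)..t, v r := by
  rw [hv.2 t, hv.2 s, intervalIntegral.integral_interval_sub_left (hv.intervalIntegrable t)
    (hv.intervalIntegrable s)]

theorem HasL2Deriv.sum_integral_norm_sq {n : ℕ} {h : PathSpace n} {v : ℝ → E n}
    (hv : HasL2Deriv h v) {k : ℕ} (c : Fin (k + 1) → ℝ≥0) :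
    ∑ i : Fin k, ∫ r in (c i.castSucc : ℝ)..c i.succ, ‖v r‖ ^ 2 =
      ∫ r in (c 0 : ℝ)..c (Fin.last k), ‖v r‖ ^ 2 := by
  induction k with
  | zero => simp
  | succ k ih =>
    have h1 := ih fun i => c i.castSucc
    simp only [Fin.castSucc_zero] at h1
    rw [Fin.sum_univ_castSucc]
    simp only [Fin.succ_castSucc, Fin.succ_last]
    rw [h1, intervalIntegral.integral_add_adjacent_intervals
      (hv.intervalIntegrable_norm_sq _ _) (hv.intervalIntegrable_norm_sq _ _)]

/-- A polygon inscribed in a path has at most the energy of the path. -/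
theorem HasL2Deriv.polygonEnergy_le {n : ℕ} {h : PathSpace n} {v : ℝ → E n}
    (hv : HasL2Deriv h v) {k : ℕ} {t : Fin k → ℝ≥0} (ht : ∀ i, 0 < t i) (hmono : StrictMono t) :
    polygonEnergy t (evalMap t h) ≤ ∫ r in Ioi (0 : ℝ), ‖v r‖ ^ 2 := by
  set c : Fin (k + 1) → ℝ≥0 := Fin.cons 0 t with hc
  have hcons : ∀ i, (Fin.cons 0 (evalMap t h) : Fin (k + 1) → E n) i = h.1 (c i) := by
    intro i
    induction i using Fin.cases with
    | zero => simpa [hc] using (show h.1 0 = 0 from h.2).symm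
    | succ i => simp [hc, evalMap]
  calc polygonEnergy t (evalMap t h)
      ≤ ∑ i : Fin k, ∫ r in (c i.castSucc : ℝ)..c i.succ, ‖v r‖ ^ 2 := by
        unfold polygonEnergy
        refine Finset.sum_le_sum fun i _ => ?_
        rw [hcons, hcons, norm_sub_rev, hv.sub_eq]
        exact sq_norm_integral_Ioc_le (by exact_mod_cast cons_zero_lt_cons_zero ht hmono i)
          (hv.memLp_Ioc _ _)
    _ = ∫ r in (c 0 : ℝ)..c (Fin.last k), ‖v r‖ ^ 2 := hv.sum_integral_norm_sq c
    _ ≤ ∫ r in Ioi (0 : ℝ), ‖v r‖ ^ 2 := by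
        have h0 : c 0 = 0 := rfl
        rw [h0, NNReal.coe_zero, intervalIntegral.integral_of_le (NNReal.coe_nonneg _)]
        exact setIntegral_mono_set hv.integrableOn_norm_sq
          (Eventually.of_forall fun _ => sq_nonneg _) Ioc_subset_Ioi_self.eventuallyLE

/-! ### The Cameron-Martin norm as a quadratic form -/

/-- An `L²` derivative is the classical derivative almost everywhere, by Lebesgue's differentiation
theorem. -/
theorem HasL2Deriv.ae_deriv_eq {n : ℕ} {h : PathSpace n} {v : ℝ → E n} (hv : HasL2Deriv h v) :
    ∀ᵐ t : ℝ, t ∈ Ioi (0 : ℝ) → deriv (fun s : ℝ => h.1 s.toNNReal) t = v t := by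
  have hN := ae_all_iff.2 fun N : ℕ => (hv.intervalIntegrable (N : ℝ≥0)).ae_hasDerivAt_integral
  filter_upwards [hN] with t ht ht0
  have ht0 : 0 < t := ht0
  obtain ⟨N, hNt⟩ := exists_nat_ge t
  have hd := ht N (by rw [uIcc_of_le (NNReal.coe_nonneg _)]; exact ⟨ht0.le, by simpa using hNt⟩)
    0 left_mem_uIcc
  refine HasDerivAt.deriv (hd.congr_of_eventuallyEq ?_)
  filter_upwards [Ioi_mem_nhds ht0] with s hs
  rw [hv.2, Real.coe_toNNReal s (le_of_lt hs)]

theorem HasL2Deriv.cmNormSq_eq {n : ℕ} {h : CameronMartin n} {v : ℝ → E n}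
    (hv : HasL2Deriv h.1 v) : cmNormSq h = ∫ t in Ioi (0 : ℝ), ‖v t‖ ^ 2 := by
  refine setIntegral_congr_ae measurableSet_Ioi ?_
  filter_upwards [hv.ae_deriv_eq] with t ht ht0
  rw [ht ht0]

theorem HasL2Deriv.linearComb {n : ℕ} {h g : PathSpace n} {v w : ℝ → E n} (hv : HasL2Deriv h v)
    (hw : HasL2Deriv g w) (a b : ℝ) : HasL2Deriv (a • h + b • g) (a • v + b • w) := by
  refine ⟨(hv.1.const_smul a).add (hw.1.const_smul b), fun t => ?_⟩
  simp only [Pi.add_apply, Pi.smul_apply]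
  have := intervalIntegral.integral_add ((hv.intervalIntegrable t).smul a)
    ((hw.intervalIntegrable t).smul b)
  simp only [Pi.smul_apply] at this
  rw [this, intervalIntegral.integral_smul,
    intervalIntegral.integral_smul, ← hv.2 t, ← hw.2 t]
  rfl

theorem HasL2Deriv.sub {n : ℕ} {h g : PathSpace n} {v w : ℝ → E n} (hv : HasL2Deriv h v)
    (hw : HasL2Deriv g w) : HasL2Deriv (h - g) (v - w) := by
  refine ⟨hv.1.sub hw.1, fun t => ?_⟩
  simp only [Pi.sub_apply]
  rw [intervalIntegral.integral_sub (hv.intervalIntegrable t) (hw.intervalIntegrable t), ← hv.2 t,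
    ← hw.2 t]
  rfl

/-- The parallelogram identity for `cmNormSq`; the difference `h₁ - h₂` enters through its `L²`
derivative. -/
theorem HasL2Deriv.cmNormSq_convexComb {n : ℕ} {h₁ h₂ : CameronMartin n} {v w : ℝ → E n}
    (hv : HasL2Deriv h₁.1 v) (hw : HasL2Deriv h₂.1 w) {a b : ℝ} (hab : a + b = 1) :
    cmNormSq (a • h₁ + b • h₂) =
      a * cmNormSq h₁ + b * cmNormSq h₂ - a * b * ∫ t in Ioi (0 : ℝ), ‖(v - w) t‖ ^ 2 := by
  have hs : HasL2Deriv (a • h₁ + b • h₂).1 (a • v + b • w) := hv.linearComb hw a b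
  have hd := hv.sub hw
  rw [hs.cmNormSq_eq, hv.cmNormSq_eq, hw.cmNormSq_eq, ← integral_const_mul,
    ← integral_const_mul, ← integral_const_mul,
    ← integral_add (hv.integrableOn_norm_sq.const_mul a) (hw.integrableOn_norm_sq.const_mul b),
    ← integral_sub (f := fun t => a * ‖v t‖ ^ 2 + b * ‖w t‖ ^ 2)
      ((hv.integrableOn_norm_sq.const_mul a).add (hw.integrableOn_norm_sq.const_mul b))
      (hd.integrableOn_norm_sq.const_mul _)]
  refine integral_congr_ae (Eventually.of_forall fun t => ?_)
  have := norm_sub_convexComb_sq hab 0 (v t) (w t)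
  simp only [zero_sub, norm_neg] at this
  simp only [Pi.add_apply, Pi.smul_apply, Pi.sub_apply, this]

/-! ### Cylinder functions generate the Borel sets of path space -/

theorem continuous_eval {n : ℕ} (t : ℝ≥0) : Continuous fun γ : PathSpace n => γ.1 t :=
  (continuous_eval_const t).comp continuous_subtype_val

theorem measurable_evalMap {n k : ℕ} (t : Fin k → ℝ≥0) :
    Measurable (evalMap t : PathSpace n → _) :=
  measurable_pi_iff.2 fun i => (continuous_eval (t i)).measurable

/-- Evaluations generate the Borel `σ`-algebra of `C(X, Y)`: for compact `K` and open `U`, membership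
in the subbasic set `{f | f(K) ⊆ U}` is decided by the values of `f` on a countable dense subset
of `K`. -/
theorem borel_continuousMap_le {X Y : Type*} [TopologicalSpace X] [PseudoMetricSpace Y]
    [MeasurableSpace Y] [BorelSpace Y] [SecondCountableTopology X]
[SecondCountableTopology C(X, Y)]
    {m : MeasurableSpace C(X, Y)} (hm : ∀ x, Measurable[m] fun f : C(X, Y) => f x) :
    borel C(X, Y) ≤ m := by
  rw [borel_eq_generateFrom_of_subbasis ContinuousMap.compactOpen_eq]
  refine MeasurableSpace.generateFrom_le ?_
  rintro _ ⟨K, hK, U, hU, rfl⟩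
  have hK : IsCompact K := hK
  have hU : IsOpen U := hU
  obtain ⟨D, hDK, hDc, hD⟩ : ∃ D ⊆ K, D.Countable ∧ K ⊆ closure D := by
    obtain ⟨D, hDc, hD⟩ := TopologicalSpace.exists_countable_dense K
    exact ⟨Subtype.val '' D, Subtype.coe_image_subset K D, hDc.image _, Subtype.dense_iff.1 hD⟩
  -- A compact image lies in `U` iff it keeps a positive distance from the complement of `U`.
  have key : {f : C(X, Y) | MapsTo f K U} =
      ⋃ N : ℕ, ⋂ x ∈ D, {f : C(X, Y) | (N : ℝ≥0∞)⁻¹ ≤ Metric.infEDist (f x) Uᶜ} := by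
    ext f
    simp only [mem_iUnion, mem_iInter, mem_ofPred_eq]
    constructor
    · intro hf
      rcases K.eq_empty_or_nonempty with rfl | hne
      · exact ⟨0, fun x hx => absurd (hDK hx) (notMem_empty x)⟩
      obtain ⟨x₀, hx₀, hmin⟩ := hK.exists_isMinOn hne
        (Metric.continuous_infEDist.comp f.continuous : Continuous fun x =>
          Metric.infEDist (f x) Uᶜ).continuousOn
      have hpos : Metric.infEDist (f x₀) Uᶜ ≠ 0 := fun h0 => by
        rw [← Metric.mem_closure_iff_infEDist_zero, hU.isClosed_compl.closure_eq] at h0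
        exact h0 (hf hx₀)
      obtain ⟨N, hN⟩ := ENNReal.exists_inv_nat_lt hpos
      exact ⟨N, fun x hx => hN.le.trans (hmin (hDK hx))⟩
    · rintro ⟨N, hN⟩ x hx
      have hcl : IsClosed {x : X | (N : ℝ≥0∞)⁻¹ ≤ Metric.infEDist (f x) Uᶜ} :=
        isClosed_le continuous_const (Metric.continuous_infEDist.comp f.continuous)
      have hx' : (N : ℝ≥0∞)⁻¹ ≤ Metric.infEDist (f x) Uᶜ :=
        (hcl.closure_subset_iff.2 fun y hy => hN y hy) (hD hx)
      by_contra hxU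
      rw [Metric.infEDist_zero_of_mem (show f x ∈ Uᶜ from hxU)] at hx'
      simp at hx'
  change MeasurableSet {f : C(X, Y) | MapsTo f K U}
  rw [key]
  exact MeasurableSet.iUnion fun N => MeasurableSet.biInter hDc fun x _ =>
    measurableSet_le measurable_const ((Metric.continuous_infEDist.measurable).comp (hm x))

/-- The times at which a path is observed at stage `m`: the positive ones among the first `m`
terms of a dense sequence. -/
noncomputable def sampleTimes (m : ℕ) : Finset ℝ≥0 :=
  ((Finset.range m).image (TopologicalSpace.denseSeq ℝ≥0)).filter (0 < ·)

/-- The times in `sampleTimes m` as a vector, in increasing order. -/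
noncomputable def sampleVector (m : ℕ) : Fin (sampleTimes m).card → ℝ≥0 :=
  (sampleTimes m).orderEmbOfFin rfl

theorem sampleVector_pos (m : ℕ) (i : Fin (sampleTimes m).card) : 0 < sampleVector m i :=
  (Finset.mem_filter.1 ((sampleTimes m).orderEmbOfFin_mem rfl i)).2

theorem sampleVector_strictMono (m : ℕ) : StrictMono (sampleVector m) :=
  ((sampleTimes m).orderEmbOfFin rfl).strictMono

theorem measurable_comap_eval {n m : ℕ} {t : ℝ≥0} (ht : t ∈ sampleTimes m) :
    Measurable[MeasurableSpace.comap (evalMap (sampleVector m)) inferInstance]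
      fun γ : PathSpace n => γ.1 t := by
  have : t ∈ Set.range (sampleVector m) := by
    rw [sampleVector, Finset.range_orderEmbOfFin]
    exact ht
  obtain ⟨i, rfl⟩ := this
  exact (measurable_pi_apply i).comp (comap_measurable (evalMap (sampleVector m)))

theorem sampleTimes_mono : Monotone sampleTimes := fun _ _ h =>
  Finset.filter_subset_filter _ (Finset.image_subset_image (Finset.range_mono h))

/-- The filtration of path space generated by observing a path at more and more times. -/
noncomputable def sampleFiltration (n : ℕ) : Filtration ℕ (instMeasurableSpacePathSpace n) where
  seq m := MeasurableSpace.comap (evalMap (sampleVector m)) inferInstance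
  mono' := by
    intro i j hij
    refine Measurable.comap_le (@measurable_pi_lambda _ _ _ (_) _ _ fun l => ?_)
    exact measurable_comap_eval (sampleTimes_mono hij ((sampleTimes i).orderEmbOfFin_mem rfl l))
  le' m := (measurable_evalMap _).comap_le

theorem iSup_sampleFiltration (n : ℕ) :
    ⨆ m, sampleFiltration n m = instMeasurableSpacePathSpace n := by
  refine le_antisymm (iSup_le (sampleFiltration n).le) ?_
  set S := ⨆ m, sampleFiltration n m
  have hdense : ∀ j, Measurable[S] fun γ : PathSpace n =>
      γ.1 (TopologicalSpace.denseSeq ℝ≥0 j) := by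
    intro j
    -- A path vanishes at time `0`, so this value carries no information.
    rcases (bot_le : 0 ≤ TopologicalSpace.denseSeq ℝ≥0 j).eq_or_lt with h0 | h0
    · have : (fun γ : PathSpace n => γ.1 (TopologicalSpace.denseSeq ℝ≥0 j)) = fun _ => 0 := by
        funext γ
        rw [← h0]
        exact γ.2
      rw [this]
      exact measurable_const
    · refine (measurable_comap_eval (m := j + 1) ?_).mono
        (le_iSup (fun m => (sampleFiltration n m)) (j + 1)) le_rfl
      exact Finset.mem_filter.2
        ⟨Finset.mem_image_of_mem _ (Finset.mem_range.2 j.lt_succ_self), h0⟩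
  have hall : ∀ t, Measurable[S] fun γ : PathSpace n => γ.1 t := by
    intro t
    obtain ⟨u, hu, hut⟩ := mem_closure_iff_seq_limit.1
      (TopologicalSpace.denseRange_denseSeq ℝ≥0 t)
    refine measurable_of_tendsto_metrizable (f := fun j (γ : PathSpace n) => γ.1 (u j))
      (fun j => ?_) (tendsto_pi_nhds.2 fun γ => (γ.1.continuous.tendsto t).comp hut)
    obtain ⟨i, hi⟩ := hu j
    rw [← hi]
    exact hdense i
  have hle : borel C(ℝ≥0, E n) ≤ MeasurableSpace.map Subtype.val S :=
    borel_continuousMap_le hall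
  change borel (PathSpace n) ≤ S
  rw [show borel (PathSpace n) = (borel C(ℝ≥0, E n)).comap Subtype.val from borel_comap]
  exact MeasurableSpace.comap_le_iff_le_map.2 hle

/-! ### Passage from a filtration to the `σ`-algebra it generates -/

/-- Lévy's upward theorem as an approximation statement: a bounded function is the almost
everywhere limit of functions with the same bound that are measurable at finite stages. -/
theorem exists_adapted_tendsto {Ω : Type*} {m0 : MeasurableSpace Ω} (ℱ : Filtration ℕ m0)
    (hℱ : ⨆ m, ℱ m = m0) (μ : Measure Ω) [IsFiniteMeasure μ] {f : Ω → ℝ≥0∞} (hf : Measurable f)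
    {M : ℝ≥0} (hM : ∀ x, f x ≤ M) :
    ∃ g : ℕ → Ω → ℝ≥0∞, (∀ m, Measurable[ℱ m] (g m)) ∧ (∀ m, ∀ᵐ x ∂μ, g m x ≤ M) ∧
      ∀ᵐ x ∂μ, Tendsto (fun m => g m x) atTop (𝓝 (f x)) := by
  have htop : ∀ x, f x ≠ ⊤ := fun x => ne_top_of_le_ne_top ENNReal.coe_ne_top (hM x)
  have hbd : ∀ x, |(f x).toReal| ≤ M := fun x => by
    rw [abs_of_nonneg ENNReal.toReal_nonneg]
    exact ENNReal.toReal_le_coe_of_le_coe (hM x)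
  have hint : Integrable (fun x => (f x).toReal) μ :=
    Integrable.of_bound hf.ennreal_toReal.aestronglyMeasurable (M : ℝ)
      (Eventually.of_forall hbd)
  refine ⟨fun m x => ENNReal.ofReal ((μ[fun x => (f x).toReal | ℱ m]) x), fun m => ?_,
    fun m => ?_, ?_⟩
  · exact stronglyMeasurable_condExp.measurable.ennreal_ofReal
  · filter_upwards [ae_bdd_abs_condExp_of_ae_bdd_abs (m := ℱ m) (Eventually.of_forall hbd)] with x hx
    rw [← ENNReal.ofReal_coe_nnreal]
    exact ENNReal.ofReal_le_ofReal ((le_abs_self _).trans hx)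
  · have hmeas : StronglyMeasurable[⨆ m, ℱ m] fun x => (f x).toReal := by
      rw [hℱ]
      exact hf.ennreal_toReal.stronglyMeasurable
    filter_upwards [hint.tendsto_ae_condExp hmeas] with x hx
    have := (ENNReal.continuous_ofReal.tendsto _).comp hx
    rwa [ENNReal.ofReal_toReal (htop x)] at this

/-- A Hölder-type inequality between three finite measures that holds at every finite stage of a
filtration holds for all measurable functions. -/
theorem lintegral_le_rpow_mul_rpow_of_filtration {Ω : Type*} {m0 : MeasurableSpace Ω}
    (ℱ : Filtration ℕ m0) (hℱ : ⨆ m, ℱ m = m0) (ν₀ ν₁ ν₂ : Measure Ω) [IsFiniteMeasure ν₀]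
    [IsFiniteMeasure ν₁] [IsFiniteMeasure ν₂] {C : ℝ≥0∞} (hC : C ≠ ⊤) {a b : ℝ} (ha : 0 < a)
    (hb : 0 < b)
    (H : ∀ m, ∀ f : Ω → ℝ≥0∞, Measurable[ℱ m] f →
      ∫⁻ x, f x ∂ν₀ ≤ C * (∫⁻ x, f x ∂ν₁) ^ a * (∫⁻ x, f x ∂ν₂) ^ b)
    {f : Ω → ℝ≥0∞} (hf : Measurable f) :
    ∫⁻ x, f x ∂ν₀ ≤ C * (∫⁻ x, f x ∂ν₁) ^ a * (∫⁻ x, f x ∂ν₂) ^ b := by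
  have bounded : ∀ (M : ℝ≥0) (f : Ω → ℝ≥0∞), Measurable f → (∀ x, f x ≤ M) →
      ∫⁻ x, f x ∂ν₀ ≤ C * (∫⁻ x, f x ∂ν₁) ^ a * (∫⁻ x, f x ∂ν₂) ^ b := by
    intro M f hf hM
    obtain ⟨g, hgm, hgM, hg⟩ := exists_adapted_tendsto ℱ hℱ (ν₀ + ν₁ + ν₂) hf hM
    have lim : ∀ ν : Measure Ω, IsFiniteMeasure ν → ν ≪ ν₀ + ν₁ + ν₂ →
        Tendsto (fun m => ∫⁻ x, g m x ∂ν) atTop (𝓝 (∫⁻ x, f x ∂ν)) := fun ν _ hν =>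
      tendsto_lintegral_of_dominated_convergence (fun _ => (M : ℝ≥0∞))
        (fun m => (hgm m).mono (ℱ.le m) le_rfl) (fun m => hν.ae_le (hgM m))
        (by simpa using ENNReal.mul_ne_top ENNReal.coe_ne_top (measure_ne_top ν univ))
        (hν.ae_le hg)
    have fin : ∀ ν : Measure Ω, IsFiniteMeasure ν → ∫⁻ x, f x ∂ν ≠ ⊤ := fun ν _ =>
      ne_top_of_le_ne_top (ENNReal.mul_ne_top ENNReal.coe_ne_top (measure_ne_top ν univ))
        ((lintegral_mono hM).trans_eq (lintegral_const _))
    have l0 := lim ν₀ inferInstance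
      (Measure.absolutelyContinuous_of_le (Measure.le_add_right (Measure.le_add_right le_rfl)))
    have l1 := lim ν₁ inferInstance
      (Measure.absolutelyContinuous_of_le (Measure.le_add_right (Measure.le_add_left le_rfl)))
    have l2 := lim ν₂ inferInstance
      (Measure.absolutelyContinuous_of_le (Measure.le_add_left le_rfl))
    have p1 := (ENNReal.continuous_rpow_const (y := a)).continuousAt.tendsto.comp l1
    have p2 := (ENNReal.continuous_rpow_const (y := b)).continuousAt.tendsto.comp l2
    have f1 : (∫⁻ x, f x ∂ν₁) ^ a ≠ ⊤ := ENNReal.rpow_ne_top_of_nonneg ha.le (fin ν₁ inferInstance)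
    have f2 : (∫⁻ x, f x ∂ν₂) ^ b ≠ ⊤ := ENNReal.rpow_ne_top_of_nonneg hb.le (fin ν₂ inferInstance)
    refine le_of_tendsto_of_tendsto' l0 (ENNReal.Tendsto.mul (ENNReal.Tendsto.const_mul p1
      (Or.inr hC)) (Or.inr f2) p2 (Or.inr (ENNReal.mul_ne_top hC f1))) fun m => H m _ (hgm m)
  have hsup : ∀ x, f x = ⨆ M : ℕ, min (f x) (M : ℝ≥0∞) := fun x => by
    rw [← inf_iSup_eq, ENNReal.iSup_natCast, inf_top_eq]
  have hmono : Monotone fun (M : ℕ) x => min (f x) (M : ℝ≥0∞) := fun i j hij x =>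
    min_le_min_left _ (by exact_mod_cast hij)
  calc ∫⁻ x, f x ∂ν₀ = ⨆ M : ℕ, ∫⁻ x, min (f x) (M : ℝ≥0∞) ∂ν₀ := by
        rw [← lintegral_iSup (fun M => hf.min measurable_const) hmono]
        exact lintegral_congr hsup
    _ ≤ C * (∫⁻ x, f x ∂ν₁) ^ a * (∫⁻ x, f x ∂ν₂) ^ b := by
        refine iSup_le fun M => (bounded M _ (hf.min measurable_const) fun x => by simp).trans ?_
        gcongr <;> exact min_le_left _ _

/-! ### The key inequality on path space and quasi-invariance -/

theorem measurable_translate {n : ℕ} (h : PathSpace n) : Measurable fun γ : PathSpace n => γ + h :=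
  (Continuous.subtype_mk (continuous_subtype_val.add (continuous_const (y := h.1))) fun γ =>
    (γ + h).2).measurable

theorem IsWienerMeasure.lintegral_convexComb_le {n : ℕ} {P : Measure (PathSpace n)}
    (hP : IsWienerMeasure n P) (h₁ h₂ : CameronMartin n) {a b : ℝ} (ha : 0 < a) (hb : 0 < b)
    (hab : a + b = 1) {f : PathSpace n → ℝ≥0∞} (hf : Measurable f) :
    ∫⁻ γ, f (γ + (a • h₁ + b • h₂ : CameronMartin n).1) ∂P ≤
      ENNReal.ofReal (Real.exp
          ((a * cmNormSq h₁ + b * cmNormSq h₂ - cmNormSq (a • h₁ + b • h₂)) / 4)) *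
        (∫⁻ γ, f (γ + h₁.1) ∂P) ^ a * (∫⁻ γ, f (γ + h₂.1) ∂P) ^ b := by
  have := hP.isProbabilityMeasure
  obtain ⟨v, hv⟩ := h₁.2
  obtain ⟨w, hw⟩ := h₂.2
  have key := lintegral_le_rpow_mul_rpow_of_filtration (sampleFiltration n)
    (iSup_sampleFiltration n) (P.map fun γ => γ + (a • h₁ + b • h₂ : CameronMartin n).1)
    (P.map fun γ => γ + h₁.1) (P.map fun γ => γ + h₂.1)
    (C := ENNReal.ofReal (Real.exp
      ((a * cmNormSq h₁ + b * cmNormSq h₂ - cmNormSq (a • h₁ + b • h₂)) / 4)))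
    ENNReal.ofReal_ne_top ha hb ?_ hf
  · simpa only [lintegral_map hf (measurable_translate _)] using key
  intro m g hg
  have hg' : Measurable g := hg.mono ((sampleFiltration n).le m) le_rfl
  obtain ⟨G, hG, rfl⟩ := Measurable.exists_eq_measurable_comp
    (f := (evalMap (sampleVector m) : PathSpace n → _)) hg
  simp only [lintegral_map hg' (measurable_translate _)]
  refine (lintegral_cylinder_convexComb_le hP (sampleVector_pos m) (sampleVector_strictMono m)
    (measurable_evalMap _) hG h₁.1 h₂.1 ha hb hab).trans ?_
  have hE := (hv.sub hw).polygonEnergy_le (sampleVector_pos m) (sampleVector_strictMono m)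
  have hN := hv.cmNormSq_convexComb hw hab
  have hle : a * b / 4 * polygonEnergy (sampleVector m) (evalMap (sampleVector m) (h₁.1 - h₂.1)) ≤
      (a * cmNormSq h₁ + b * cmNormSq h₂ - cmNormSq (a • h₁ + b • h₂)) / 4 := by
    have := mul_le_mul_of_nonneg_left hE (mul_pos ha hb).le
    rw [hN]
    linarith
  dsimp only [Function.comp_apply]
  gcongr

/-- Translation by a Cameron-Martin path preserves null sets: if `A` is null, apply the key
inequality to `h = ½ • 0 + ½ • (2 • h)`, whose right-hand side contains the factor `P(A) ^ ½`. -/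
theorem IsWienerMeasure.quasiMeasurePreserving {n : ℕ} {P : Measure (PathSpace n)}
    (hP : IsWienerMeasure n P) (h : CameronMartin n) :
    Measure.QuasiMeasurePreserving (fun γ => γ + h.1) P P := by
  refine ⟨measurable_translate _, Measure.AbsolutelyContinuous.mk fun s hs hPs => ?_⟩
  have key := hP.lintegral_convexComb_le 0 ((2 : ℝ) • h) (a := 1 / 2) (b := 1 / 2) (by norm_num)
    (by norm_num) (by norm_num) (measurable_const.indicator hs : Measurable (s.indicator 1))
  have e : (1 / 2 : ℝ) • (0 : CameronMartin n) + (1 / 2 : ℝ) • (2 : ℝ) • h = h := by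
    rw [smul_zero, zero_add, smul_smul]
    norm_num
  have e0 : ∫⁻ γ, s.indicator 1 (γ + (0 : CameronMartin n).1) ∂P = 0 := by
    have : ∀ γ : PathSpace n, γ + (0 : CameronMartin n).1 = γ := fun γ => add_zero γ
    simp only [this, lintegral_indicator_one hs, hPs]
  rw [e, e0, ENNReal.zero_rpow_of_pos (by norm_num), mul_zero, zero_mul, nonpos_iff_eq_zero,
    ← lintegral_map (measurable_const.indicator hs : Measurable (s.indicator 1))
      (measurable_translate _), lintegral_indicator_one hs] at key
  exact key

theorem IsWienerMeasure.lintegral_convexComb_le_of_aemeasurable {n : ℕ} {P : Measure (PathSpace n)}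
    (hP : IsWienerMeasure n P) (h₁ h₂ : CameronMartin n) {a b : ℝ} (ha : 0 < a) (hb : 0 < b)
    (hab : a + b = 1) {f : PathSpace n → ℝ≥0∞} (hf : AEMeasurable f P) :
    ∫⁻ γ, f (γ + (a • h₁ + b • h₂ : CameronMartin n).1) ∂P ≤
      ENNReal.ofReal (Real.exp
          ((a * cmNormSq h₁ + b * cmNormSq h₂ - cmNormSq (a • h₁ + b • h₂)) / 4)) *
        (∫⁻ γ, f (γ + h₁.1) ∂P) ^ a * (∫⁻ γ, f (γ + h₂.1) ∂P) ^ b := by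
  have e : ∀ h : CameronMartin n, ∫⁻ γ, f (γ + h.1) ∂P = ∫⁻ γ, hf.mk f (γ + h.1) ∂P := fun h =>
    lintegral_congr_ae ((hP.quasiMeasurePreserving h).ae_eq_comp hf.ae_eq_mk)
  rw [e, e, e]
  exact hP.lintegral_convexComb_le h₁ h₂ ha hb hab hf.measurable_mk

/-! ### Convexity of the logarithm -/

theorem log_add_le_of_le_rpow_mul_rpow {A₀ A₁ A₂ : ℝ≥0∞} (hA₁ : A₁ ≠ 0) (hA₂ : A₂ ≠ 0)
    {q₀ q₁ q₂ a b : ℝ} (ha : 0 < a) (hb : 0 < b)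
    (h : A₀ ≤ ENNReal.ofReal (Real.exp ((a * q₁ + b * q₂ - q₀) / 4)) * A₁ ^ a * A₂ ^ b) :
    ENNReal.log A₀ + ((1 / 4 * q₀ : ℝ) : EReal) ≤
      (a : EReal) * (ENNReal.log A₁ + ((1 / 4 * q₁ : ℝ) : EReal)) +
        (b : EReal) * (ENNReal.log A₂ + ((1 / 4 * q₂ : ℝ) : EReal)) := by
  have hlog := ENNReal.log_le_log h
  rw [ENNReal.log_mul_add, ENNReal.log_mul_add, ENNReal.log_rpow, ENNReal.log_rpow,
    ENNReal.log_ofReal_of_pos (Real.exp_pos _), Real.log_exp] at hlog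
  have hb₁ : ENNReal.log A₁ ≠ ⊥ := by simpa using hA₁
  have hb₂ : ENNReal.log A₂ ≠ ⊥ := by simpa using hA₂
  revert hlog hb₁ hb₂
  generalize ENNReal.log A₀ = x₀
  generalize ENNReal.log A₁ = x₁
  generalize ENNReal.log A₂ = x₂
  intro hlog hb₁ hb₂
  induction x₁ with
  | bot => exact absurd rfl hb₁
  | top =>
    induction x₂ with
    | bot => exact absurd rfl hb₂
    | top =>
      rw [EReal.top_add_coe, EReal.top_add_coe, EReal.coe_mul_top_of_pos ha,
        EReal.coe_mul_top_of_pos hb, EReal.top_add_top]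
      exact le_top
    | coe x₂ =>
      rw [EReal.top_add_coe, EReal.coe_mul_top_of_pos ha, ← EReal.coe_add, ← EReal.coe_mul,
        EReal.top_add_coe]
      exact le_top
  | coe x₁ =>
    induction x₂ with
    | bot => exact absurd rfl hb₂
    | top =>
      rw [EReal.top_add_coe, EReal.coe_mul_top_of_pos hb, ← EReal.coe_add, ← EReal.coe_mul,
        EReal.coe_add_top]
      exact le_top
    | coe x₂ =>
      refine (add_le_add_left hlog _).trans (le_of_eq ?_)
      norm_cast
      ring

end PathSpaceHarnack

theorem mainTheorem4 (n : ℕ) (P : Measure (PathSpaceHarnack.PathSpace n))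
    (hP : PathSpaceHarnack.IsWienerMeasure n P)
    (F : PathSpaceHarnack.PathSpace n → ℝ) (hFpos : ∀ γ, 0 < F γ) (hFint : Integrable F P) :
    (∀ h : PathSpaceHarnack.CameronMartin n, PathSpaceHarnack.Phi P F h ≠ ⊥) ∧
    PathSpaceHarnack.Phi P F 0 ≠ ⊤ ∧
    (∀ (h₁ h₂ : PathSpaceHarnack.CameronMartin n) (a b : ℝ), 0 < a → 0 < b → a + b = 1 →
      PathSpaceHarnack.Phi P F (a • h₁ + b • h₂) ≤
        (a : EReal) * PathSpaceHarnack.Phi P F h₁ + (b : EReal) * PathSpaceHarnack.Phi P F h₂) ∧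
    (∀ h : PathSpaceHarnack.CameronMartin n, Integrable (fun γ => F (γ + h.1)) P →
      PathSpaceHarnack.Phi P F h = (PathSpaceHarnack.PhiReal P F h : EReal)) ∧
    ConvexOn ℝ {h : PathSpaceHarnack.CameronMartin n | Integrable (fun γ => F (γ + h.1)) P}
      (PathSpaceHarnack.PhiReal P F) := by
  have := hP.isProbabilityMeasure
  have hf : AEMeasurable (fun γ => ENNReal.ofReal (F γ)) P :=
    hFint.aestronglyMeasurable.aemeasurable.ennreal_ofReal
  have hae : ∀ h : PathSpaceHarnack.CameronMartin n,
      AEStronglyMeasurable (fun γ => F (γ + h.1)) P := fun h =>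
    hFint.aestronglyMeasurable.comp_quasiMeasurePreserving (hP.quasiMeasurePreserving h)
  -- `∫⁻` of a positive function can vanish unless the function is almost everywhere measurable;
  -- for the translates of `F` this is where quasi-invariance enters.
  have hne0 : ∀ h : PathSpaceHarnack.CameronMartin n,
      ∫⁻ γ, ENNReal.ofReal (F (γ + h.1)) ∂P ≠ 0 := by
    intro h h0
    rw [lintegral_eq_zero_iff' (hae h).aemeasurable.ennreal_ofReal] at h0
    obtain ⟨γ, hγ⟩ := h0.exists
    exact absurd hγ (by simpa using hFpos _)
  have htop : ∀ h : PathSpaceHarnack.CameronMartin n, Integrable (fun γ => F (γ + h.1)) P ↔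
      ∫⁻ γ, ENNReal.ofReal (F (γ + h.1)) ∂P ≠ ⊤ := fun h => by
    rw [← lt_top_iff_ne_top, ← hasFiniteIntegral_iff_ofReal
      (Filter.Eventually.of_forall fun γ => (hFpos _).le)]
    exact ⟨fun hi => hi.2, fun hi => ⟨hae h, hi⟩⟩
  have hkey := fun (h₁ h₂ : PathSpaceHarnack.CameronMartin n) (a b : ℝ) (ha : 0 < a) (hb : 0 < b)
    (hab : a + b = 1) => hP.lintegral_convexComb_le_of_aemeasurable h₁ h₂ ha hb hab hf
  have hconv : ∀ (h₁ h₂ : PathSpaceHarnack.CameronMartin n) (a b : ℝ), 0 < a → 0 < b → a + b = 1 →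
      PathSpaceHarnack.Phi P F (a • h₁ + b • h₂) ≤
        (a : EReal) * PathSpaceHarnack.Phi P F h₁ + (b : EReal) * PathSpaceHarnack.Phi P F h₂ :=
    fun h₁ h₂ a b ha hb hab => PathSpaceHarnack.log_add_le_of_le_rpow_mul_rpow (hne0 h₁) (hne0 h₂)
      ha hb (hkey h₁ h₂ a b ha hb hab)
  have hreal : ∀ h : PathSpaceHarnack.CameronMartin n, Integrable (fun γ => F (γ + h.1)) P →
      PathSpaceHarnack.Phi P F h = (PathSpaceHarnack.PhiReal P F h : EReal) := by
    intro h hi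
    have h0 := hne0 h
    unfold PathSpaceHarnack.Phi PathSpaceHarnack.PhiReal
    rw [← ofReal_integral_eq_lintegral_ofReal hi
      (Filter.Eventually.of_forall fun γ => (hFpos _).le)] at h0 ⊢
    rw [ENNReal.log_ofReal_of_pos (by simpa using h0), EReal.coe_add]
  have hset : ∀ h₁ h₂ : PathSpaceHarnack.CameronMartin n, Integrable (fun γ => F (γ + h₁.1)) P →
      Integrable (fun γ => F (γ + h₂.1)) P → ∀ a b : ℝ, 0 < a → 0 < b → a + b = 1 →
      Integrable (fun γ => F (γ + (a • h₁ + b • h₂ : PathSpaceHarnack.CameronMartin n).1)) P := by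
    intro h₁ h₂ hi₁ hi₂ a b ha hb hab
    rw [htop] at hi₁ hi₂ ⊢
    exact ne_top_of_le_ne_top (ENNReal.mul_ne_top (ENNReal.mul_ne_top ENNReal.ofReal_ne_top
      (ENNReal.rpow_ne_top_of_nonneg ha.le hi₁)) (ENNReal.rpow_ne_top_of_nonneg hb.le hi₂))
      (hkey h₁ h₂ a b ha hb hab)
  have hzero : Integrable
      (fun γ => F (γ + (0 : PathSpaceHarnack.CameronMartin n).1)) P := by
    have e : ∀ γ : PathSpaceHarnack.PathSpace n,
        γ + (0 : PathSpaceHarnack.CameronMartin n).1 = γ := fun γ => add_zero γ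
    simpa only [e] using hFint
  refine ⟨fun h => ?_, ?_, hconv, hreal, ?_⟩
  · unfold PathSpaceHarnack.Phi
    rw [Ne, EReal.add_eq_bot_iff, ENNReal.log_eq_bot_iff]
    exact fun h' => h'.elim (hne0 h) (EReal.coe_ne_bot _)
  · rw [hreal 0 hzero]
    exact EReal.coe_ne_top _
  · refine convexOn_iff_forall_pos.2 ⟨convex_iff_forall_pos.2 ?_, ?_⟩
    · exact fun h₁ hi₁ h₂ hi₂ a b ha hb hab => hset h₁ h₂ hi₁ hi₂ a b ha hb hab
    · intro h₁ hi₁ h₂ hi₂ a b ha hb hab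
      have h := hconv h₁ h₂ a b ha hb hab
      rw [hreal _ (hset h₁ h₂ hi₁ hi₂ a b ha hb hab), hreal _ hi₁, hreal _ hi₂] at h
      exact_mod_cast h
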